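/- Let $\theta=(\lambda,p)\in[0,\infty)\times[0,1]$ and let $f_\theta$ be the probability mass function of a pair $(X,K)$ such that $K\sim\mathrm{Poisson}(\lambda)$ and, conditionally on $K$, $X\sim\mathrm{Binomial}(K,p)$. For a probability distribution $H$ of $\theta$ put $f_H(y)=\int f_\theta(y)\,dH(\theta)$. Let $T\subset[0,\infty)\times[0,1]$ be a bounded set of parameters, let $G$ be a probability distribution on $T$, and let $Y_i=(X_i,K_i)$, $i=1,2,\dots$, be iid with density $f_G$. A GMLE based on $Y_1,\dots,Y_n$ is a probability distribution $\hat G_n$ on $T$ that maximizes $\prod_{i=1}^n f_H(Y_i)$ over all probability distributions $H$ on $T$. Put $\xi(\theta)=(\xi_1,\xi_2)=(p\lambda,(1-p)\lambda)$ and $S=\xi(T)$. Then, almost surely, for every sequence $(\hat G_n)_{n\ge1}$ in which each $\hat G_n$ is a GMLE based on $Y_1,\dots,Y_n$: (a) for every function $\eta(\theta)=\psi(\xi(\theta))$, where $\psi$ is a measurable function that is bounded on $S$ and that, as a function on $S$, is continuous at every point of $S$ belonging to the support of the distribution of $(\xi_1,\xi_2)$ under $G$, $$E_{\hat G_n}\,\eta(\Theta)\longrightarrow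 E_G\,\eta(\Theta)\qquad(n\to\infty);$$ (b) if $G(\{\lambda=0\})=0$, then, with $\Theta=(\Theta_1,\Theta_2)=(\lambda,p)$, $$E_{\hat G_n}\,\Theta_2\longrightarrow E_G\,\Theta_2\qquad(n\to\infty),$$ that is, the GMLE estimator of $p$ is consistent. -/

import Mathlib

open MeasureTheory ProbabilityTheory Filter Topology

open scoped NNReal unitInterval

noncomputable section

namespace PoissonMixture

/-- A parameter `θ = (rate, p)`: the Poisson rate of the sample size of a stratum and the
success probability in that stratum. -/
abbrev Param : Type := ℝ≥0 × I

/-- `f_θ(x, k)`, the probability of `(X, K) = (x, k)` given `θ = (rate, p)`, when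
`K ∼ Poisson(rate)` and, conditionally on `K = k`, `X ∼ Binomial(k, p)`. -/
def condDensity (θ : Param) (y : ℕ × ℕ) : ℝ :=
  (poissonMeasure θ.1).real {y.2} * (binomial y.2 θ.2).real {y.1}

/-- The mixture density `f_G(y) = ∫ f_θ(y) dG(θ)`. -/
def mixtureDensity (G : Measure Param) (y : ℕ × ℕ) : ℝ :=
  ∫ θ, condDensity θ y ∂G

/-- `G` is a probability distribution on the set `T` of parameters. -/
def IsDistributionOn (T : Set Param) (G : Measure Param) : Prop :=
  IsProbabilityMeasure G ∧ G Tᶜ = 0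

/-- `Ghat` is a generalized maximum likelihood estimator (GMLE) based on the observations
`y 0, …, y (n - 1)`: it maximizes the likelihood `∏ i, f_H(y i)` over all probability
distributions `H` on the parameter set `T`. -/
def IsGMLE (T : Set Param) {n : ℕ} (y : Fin n → ℕ × ℕ) (Ghat : Measure Param) : Prop :=
  IsDistributionOn T Ghat ∧
    ∀ H : Measure Param, IsDistributionOn T H →
      ∏ i, mixtureDensity H (y i) ≤ ∏ i, mixtureDensity Ghat (y i)

/-- The random pairs `Y 0, Y 1, …` (with `Y i = (X i, K i)`) are iid with density `f_G`. -/
structure IsSample {Ω : Type*} [MeasurableSpace Ω] (P : Measure Ω) (G : Measure Param)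
    (Y : ℕ → Ω → ℕ × ℕ) : Prop where
  measurable : ∀ i, Measurable (Y i)
  indep : iIndepFun Y P
  density : ∀ i y, P.real (Y i ⁻¹' {y}) = mixtureDensity G y

/-- The reparametrization `ξ = (ξ₁, ξ₂) = (p * rate, (1 - p) * rate)`. -/
def xi (θ : Param) : ℝ × ℝ :=
  ((θ.2 : ℝ) * (θ.1 : ℝ), (1 - (θ.2 : ℝ)) * (θ.1 : ℝ))

end PoissonMixture

end

/-!
The argument has three steps.

*Densities.* Moving from a GMLE `Ghat` towards the true mixing distribution `G` cannot increase the
likelihood, so the derivative in that direction is nonpositive; this says that the empirical mean of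
`f_G / f_Ghat` over the observations is at most `1` (`IsGMLE.sum_ratio_le`). Almost surely the
empirical frequencies converge to `f_G` (`IsSample.ae_tendsto_freq`), and the inequality
`(f_G - h) ^ 2 ≤ f_G ^ 2 / h - 2 f_G + h` for `h = f_Ghat ≤ 1` then gives `f_Ghat → f_G` pointwise
(`tendsto_of_sum_mul_ratio_le_one`).

*Weak convergence.* With `k = x + b` and
`(ξ₁, ξ₂) = ξ(θ)`, the density `f_θ(x, k)` is a constant times
`exp (-(ξ₁ + ξ₂)) * ξ₁ ^ x * ξ₂ ^ b`. The parameter set is bounded, so by Stone–Weierstrass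
convergence of all these integrals yields convergence of `∫ F(ξ(θ)) dGhat` for every continuous `F`
(`tendsto_integral_comp_xi`).

*Functionals.* A bounded `ψ` on `S = ξ(T)` is approximated from below by its Lipschitz minorants,
which increase to `ψ` at every continuity point, and from above by applying this to `-ψ`
(`tendsto_integral_of_ae_continuous`). The success probability is squeezed between two continuous
functions of `ξ` that differ only for rates near `0` (`tendsto_integral_prob`).
-/

namespace PoissonMixture

/-! ### Conditional and mixture densities -/

lemma condDensity_eq (θ : Param) (x k : ℕ) :
    condDensity θ (x, k) = (k.choose x / k.factorial : ℝ) *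
      (Real.exp (-((xi θ).1 + (xi θ).2)) * ((xi θ).1 ^ x * (xi θ).2 ^ (k - x))) := by
  rcases lt_or_ge k x with h | h
  · simp [condDensity, binomial_real_singleton, Nat.choose_eq_zero_of_lt h]
  · obtain ⟨m, rfl⟩ := Nat.exists_eq_add_of_le h
    have hs : (xi θ).1 + (xi θ).2 = (θ.1 : ℝ) := by simp only [xi]; ring
    rw [hs]
    simp only [condDensity, binomial_real_singleton, poissonMeasure_real_singleton, xi,
      Nat.add_sub_cancel_left, mul_pow, pow_add]
    ring

lemma continuous_xi : Continuous xi := by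
  unfold xi; fun_prop

lemma continuous_condDensity (y : ℕ × ℕ) : Continuous fun θ => condDensity θ y := by
  obtain ⟨x, k⟩ := y
  have := continuous_xi
  simp only [condDensity_eq]
  fun_prop

lemma condDensity_nonneg (θ : Param) (y : ℕ × ℕ) : 0 ≤ condDensity θ y := by
  unfold condDensity; positivity

lemma sum_condDensity_le_one (θ : Param) (A : Finset (ℕ × ℕ)) :
    ∑ y ∈ A, condDensity θ y ≤ 1 := by
  classical
  have hprob : ∀ (μ : Measure ℕ) [IsProbabilityMeasure μ] (s : Finset ℕ),
      ∑ j ∈ s, μ.real {j} ≤ 1 := fun μ _ s => by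
    rw [sum_measureReal_singleton]; exact measureReal_le_one
  calc ∑ y ∈ A, condDensity θ y
      ≤ ∑ y ∈ A.image Prod.fst ×ˢ A.image Prod.snd, condDensity θ y :=
        Finset.sum_le_sum_of_subset_of_nonneg Finset.subset_product
          fun y _ _ => condDensity_nonneg θ y
    _ = ∑ k ∈ A.image Prod.snd, (poissonMeasure θ.1).real {k} *
          ∑ x ∈ A.image Prod.fst, (binomial k θ.2).real {x} := by
        rw [Finset.sum_product_right]
        simp only [condDensity, Finset.mul_sum]
    _ ≤ ∑ k ∈ A.image Prod.snd, (poissonMeasure θ.1).real {k} :=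
        Finset.sum_le_sum fun k _ =>
          mul_le_of_le_one_right measureReal_nonneg (hprob (binomial k θ.2) _)
    _ ≤ 1 := hprob (poissonMeasure θ.1) _

lemma integrable_condDensity (H : Measure Param) [IsFiniteMeasure H] (y : ℕ × ℕ) :
    Integrable (fun θ => condDensity θ y) H := by
  refine Integrable.of_bound (continuous_condDensity y).aestronglyMeasurable 1
    (ae_of_all _ fun θ => ?_)
  rw [Real.norm_of_nonneg (condDensity_nonneg θ y)]
  simpa using sum_condDensity_le_one θ {y}

lemma mixtureDensity_nonneg (H : Measure Param) (y : ℕ × ℕ) : 0 ≤ mixtureDensity H y :=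
  integral_nonneg fun θ => condDensity_nonneg θ y

lemma sum_mixtureDensity_le_one (H : Measure Param) [IsProbabilityMeasure H]
    (A : Finset (ℕ × ℕ)) : ∑ y ∈ A, mixtureDensity H y ≤ 1 := by
  unfold mixtureDensity
  rw [← integral_finsetSum _ fun y _ => integrable_condDensity H y]
  calc ∫ θ, ∑ y ∈ A, condDensity θ y ∂H ≤ ∫ _, (1 : ℝ) ∂H :=
        integral_mono (integrable_finsetSum _ fun y _ => integrable_condDensity H y)
          (integrable_const _) fun θ => sum_condDensity_le_one θ A
    _ = 1 := by simp

/-! ### First-order optimality of the GMLE -/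

/-- The convex combination `(1 - t) H₀ + t H₁` of two mixing distributions on `T` is one as well,
and the mixture density is affine along it. -/
lemma exists_isDistributionOn_segment {T : Set Param} {H₀ H₁ : Measure Param}
    (h₀ : IsDistributionOn T H₀) (h₁ : IsDistributionOn T H₁) {t : ℝ} (ht0 : 0 ≤ t)
    (ht1 : t ≤ 1) :
    ∃ H, IsDistributionOn T H ∧
      ∀ y, mixtureDensity H y = (1 - t) * mixtureDensity H₀ y + t * mixtureDensity H₁ y := by
  have := h₀.1
  have := h₁.1
  refine ⟨ENNReal.ofReal (1 - t) • H₀ + ENNReal.ofReal t • H₁, ⟨⟨?_⟩, ?_⟩, fun y => ?_⟩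
  · simp [← ENNReal.ofReal_add (sub_nonneg.2 ht1) ht0]
  · simp [h₀.2, h₁.2]
  · unfold mixtureDensity
    rw [integral_add_measure ((integrable_condDensity H₀ y).smul_measure ENNReal.ofReal_ne_top)
      ((integrable_condDensity H₁ y).smul_measure ENNReal.ofReal_ne_top)]
    simp [integral_smul_measure, ENNReal.toReal_ofReal ht0,
      ENNReal.toReal_ofReal (sub_nonneg.2 ht1)]

/-- First-order optimality: if `∏ (1 + t u i)` is at most its value `1` at `t = 0` for all small
`t > 0`, then its derivative `∑ u i` at `0` is nonpositive. -/
lemma sum_nonpos_of_prod_one_add_mul_le_one {ι : Type*} [Fintype ι] (u : ι → ℝ)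
    (hu : ∀ i, -1 ≤ u i) (h : ∀ t : ℝ, 0 < t → t < 1 → ∏ i, (1 + t * u i) ≤ 1) :
    ∑ i, u i ≤ 0 := by
  have hcont : Tendsto (fun t : ℝ => ∑ i, u i / (1 + t * u i)) (𝓝[>] 0) (𝓝 (∑ i, u i)) := by
    refine tendsto_finsetSum _ fun i _ => ?_
    have : ContinuousAt (fun t : ℝ => u i / (1 + t * u i)) 0 :=
      ContinuousAt.div (by fun_prop) (by fun_prop) (by simp)
    simpa using this.tendsto.mono_left nhdsWithin_le_nhds
  refine le_of_tendsto hcont ?_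
  filter_upwards [Ioo_mem_nhdsGT (zero_lt_one : (0 : ℝ) < 1)] with t ht
  have hpos : ∀ i, 0 < 1 + t * u i := fun i => by nlinarith [hu i, ht.1, ht.2]
  have hlog : ∑ i, Real.log (1 + t * u i) ≤ 0 := by
    rw [← Real.log_prod fun i _ => (hpos i).ne']
    exact Real.log_nonpos (Finset.prod_nonneg fun i _ => (hpos i).le) (h t ht.1 ht.2)
  have hle : ∑ i, t * (u i / (1 + t * u i)) ≤ 0 := by
    refine le_trans (Finset.sum_le_sum fun i _ => ?_) hlog
    -- `log (1 + x) ≥ x / (1 + x)` avoids differentiating the product.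
    have h1 := Real.one_sub_inv_le_log_of_pos (hpos i)
    have h2 : t * (u i / (1 + t * u i)) = 1 - (1 + t * u i)⁻¹ := by
      field_simp [(hpos i).ne']; ring
    linarith
  rw [← Finset.mul_sum] at hle
  exact nonpos_of_mul_nonpos_right hle ht.1

/-- The first-order condition for a GMLE, in the direction of a distribution `G` under which
every observation has positive density. -/
lemma IsGMLE.sum_ratio_le {T : Set Param} {n : ℕ} {y : Fin n → ℕ × ℕ} {Ghat G : Measure Param}
    (h : IsGMLE T y Ghat) (hG : IsDistributionOn T G) (hpos : ∀ i, 0 < mixtureDensity G (y i)) :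
    (∀ i, 0 < mixtureDensity Ghat (y i)) ∧
      ∑ i, mixtureDensity G (y i) / mixtureDensity Ghat (y i) ≤ n := by
  have hpos' : ∀ i, 0 < mixtureDensity Ghat (y i) := by
    have : 0 < ∏ i, mixtureDensity Ghat (y i) :=
      (Finset.prod_pos fun i _ => hpos i).trans_le (h.2 G hG)
    intro i
    exact (mixtureDensity_nonneg _ _).lt_of_ne'
      (Finset.prod_ne_zero_iff.1 this.ne' i (Finset.mem_univ i))
  refine ⟨hpos', ?_⟩
  have key : ∑ i, (mixtureDensity G (y i) / mixtureDensity Ghat (y i) - 1) ≤ 0 := by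
    refine sum_nonpos_of_prod_one_add_mul_le_one _ (fun i => ?_) fun t ht0 ht1 => ?_
    · have := div_nonneg (hpos i).le (hpos' i).le
      linarith
    · obtain ⟨H, hH, hHd⟩ := exists_isDistributionOn_segment h.1 hG ht0.le ht1.le
      have hle := h.2 H hH
      have hP : 0 < ∏ i, mixtureDensity Ghat (y i) := Finset.prod_pos fun i _ => hpos' i
      have heq : ∏ i, (1 + t * (mixtureDensity G (y i) / mixtureDensity Ghat (y i) - 1)) =
          (∏ i, mixtureDensity H (y i)) / ∏ i, mixtureDensity Ghat (y i) := by
        rw [← Finset.prod_div_distrib]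
        refine Finset.prod_congr rfl fun i _ => ?_
        have := (hpos' i).ne'
        rw [hHd]; field_simp; ring
      rw [heq]
      exact (div_le_one hP).2 hle
  simpa using key

/-! ### Pointwise convergence of the mixture densities -/

/-- Let `g` be a probability mass function, `h n` sub-probability mass functions and `q n → g`
pointwise, where `∑ q n * (g / h n) ≤ 1`. Then `h n → g` pointwise: on a finite set `A` carrying
most of the mass of `g`, `∑ (g - h n) ^ 2 ≤ ∑ (g ^ 2 / h n - 2 g + h n)`, and the right-hand side
is nearly at most `1 - 2 + 1 = 0`. -/
lemma tendsto_of_sum_mul_ratio_le_one {α : Type*} {g : α → ℝ} {h q : ℕ → α → ℝ}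
    (hg : HasSum g 1) (hg0 : ∀ y, 0 ≤ g y) (hh0 : ∀ᶠ n in atTop, ∀ y, 0 ≤ h n y)
    (hh1 : ∀ᶠ n in atTop, ∀ A : Finset α, ∑ y ∈ A, h n y ≤ 1)
    (hq : ∀ y, Tendsto (fun n => q n y) atTop (𝓝 (g y)))
    (hpos : ∀ᶠ n in atTop, ∀ y, 0 < q n y → 0 < h n y)
    (hratio : ∀ᶠ n in atTop, ∀ A : Finset α, ∑ y ∈ A, q n y * (g y / h n y) ≤ 1) (y : α) :
    Tendsto (fun n => h n y) atTop (𝓝 (g y)) := by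
  classical
  rw [Metric.tendsto_nhds]
  intro δ hδ
  set ε : ℝ := δ ^ 2 / 4 with hε
  have hε0 : 0 < ε := by positivity
  obtain ⟨A, hyA, hA⟩ : ∃ A : Finset α, y ∈ A ∧ 1 - ε < ∑ z ∈ A, g z := by
    have h1 : ∀ᶠ A : Finset α in atTop, 1 - ε < ∑ z ∈ A, g z :=
      hg.eventually (lt_mem_nhds (by linarith))
    obtain ⟨A, hA⟩ := (h1.and (eventually_ge_atTop {y})).exists
    exact ⟨A, Finset.singleton_subset_iff.1 hA.2, hA.1⟩
  have hqA : ∀ᶠ n in atTop, ∀ z ∈ A, 0 < g z → g z < (1 + ε) * q n z := by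
    rw [eventually_all_finset]
    intro z _
    by_cases hz : 0 < g z
    · filter_upwards [((hq z).const_mul (1 + ε)).eventually
        (lt_mem_nhds (show g z < (1 + ε) * g z by nlinarith))] with n hn _ using hn
    · exact Eventually.of_forall fun n hn => absurd hn hz
  filter_upwards [hh0, hh1, hpos, hratio, hqA] with n hh0 hh1 hpos hratio hqA
  have hterm : ∀ z ∈ A, (g z - h n z) ^ 2 ≤
      (1 + ε) * (q n z * (g z / h n z)) - 2 * g z + h n z := by
    intro z hz
    have hz1 : h n z ≤ 1 := by simpa using hh1 {z}
    rcases (hg0 z).eq_or_lt with h0 | h0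
    · -- Here `g z / h n z = 0`, also when `h n z = 0`, and what remains is `(h n z) ^ 2 ≤ h n z`.
      rw [← h0]
      have := hh0 z
      simp only [zero_div, mul_zero]
      nlinarith
    · have hqz := hqA z hz h0
      have hqpos : 0 < q n z := by
        by_contra hcon
        nlinarith
      have hhz := hpos z hqpos
      calc (g z - h n z) ^ 2 ≤ (g z - h n z) ^ 2 / h n z :=
            le_div_self (sq_nonneg _) hhz hz1
        _ = g z * (g z / h n z) - 2 * g z + h n z := by field_simp; ring
        _ ≤ _ := by
          have : 0 ≤ g z / h n z := by positivity
          nlinarith [mul_le_mul_of_nonneg_right hqz.le this]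
  have hsum : (g y - h n y) ^ 2 ≤ 3 * ε := by
    calc (g y - h n y) ^ 2 ≤ ∑ z ∈ A, (g z - h n z) ^ 2 :=
          Finset.single_le_sum (f := fun z => (g z - h n z) ^ 2)
            (fun z _ => sq_nonneg _) hyA
      _ ≤ ∑ z ∈ A, ((1 + ε) * (q n z * (g z / h n z)) - 2 * g z + h n z) :=
          Finset.sum_le_sum hterm
      _ = (1 + ε) * ∑ z ∈ A, q n z * (g z / h n z) - 2 * ∑ z ∈ A, g z + ∑ z ∈ A, h n z := by
          rw [Finset.sum_add_distrib, Finset.sum_sub_distrib, Finset.mul_sum, Finset.mul_sum]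
      _ ≤ 3 * ε := by
          nlinarith [hratio A, hh1 A, mul_le_mul_of_nonneg_left (hratio A)
            (by linarith : (0 : ℝ) ≤ 1 + ε)]
  rw [dist_comm, Real.dist_eq]
  refine abs_lt_of_sq_lt_sq ?_ hδ.le
  nlinarith [sq_nonneg δ, pow_pos hδ 2]

/-- The relative frequency of `y` among the first `n` terms of the sequence `s`. -/
noncomputable def freq (s : ℕ → ℕ × ℕ) (n : ℕ) (y : ℕ × ℕ) : ℝ :=
  (∑ i ∈ Finset.range n, Set.indicator {y} (fun _ => (1 : ℝ)) (s i)) / n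

lemma exists_eq_of_freq_pos {s : ℕ → ℕ × ℕ} {n : ℕ} {y : ℕ × ℕ} (h : 0 < freq s n y) :
    ∃ i < n, s i = y := by
  by_contra! hcon
  refine h.ne' ?_
  unfold freq
  rw [Finset.sum_eq_zero, zero_div]
  intro i hi
  simp [hcon i (Finset.mem_range.1 hi)]

/-- A finite part of the empirical mean of `r ≥ 0` is at most the full empirical mean. -/
lemma sum_freq_mul_le {s : ℕ → ℕ × ℕ} {n : ℕ} {r : ℕ × ℕ → ℝ} (hr : ∀ y, 0 ≤ r y)
    (A : Finset (ℕ × ℕ)) :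
    ∑ y ∈ A, freq s n y * r y ≤ (∑ i ∈ Finset.range n, r (s i)) / n := by
  classical
  have h : ∑ y ∈ A, freq s n y * r y =
      (∑ i ∈ Finset.range n, ∑ y ∈ A, Set.indicator {y} (fun _ => (1 : ℝ)) (s i) * r y) / n := by
    rw [Finset.sum_comm, Finset.sum_div]
    refine Finset.sum_congr rfl fun y _ => ?_
    rw [freq, div_mul_eq_mul_div, Finset.sum_mul]
  rw [h]
  refine div_le_div_of_nonneg_right (Finset.sum_le_sum fun i _ => ?_) n.cast_nonneg
  simp only [Set.indicator_apply, Set.mem_singleton_iff, ite_mul, one_mul, zero_mul,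
    Finset.sum_ite_eq]
  split_ifs
  · exact le_rfl
  · exact hr _

section Sample

variable {Ω : Type*} [MeasurableSpace Ω] {P : Measure Ω} [IsProbabilityMeasure P]
  {G : Measure Param} {Y : ℕ → Ω → ℕ × ℕ}

lemma IsSample.identDistrib (hY : IsSample P G Y) (i : ℕ) : IdentDistrib (Y i) (Y 0) P P := by
  refine ⟨(hY.measurable i).aemeasurable, (hY.measurable 0).aemeasurable, ?_⟩
  refine Measure.ext_of_singleton fun y => ?_
  rw [Measure.map_apply (hY.measurable i) (measurableSet_singleton y),
    Measure.map_apply (hY.measurable 0) (measurableSet_singleton y)]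
  have h := (hY.density i y).trans (hY.density 0 y).symm
  simpa [measureReal_def, ENNReal.toReal_eq_toReal_iff'] using h

lemma IsSample.hasSum_mixtureDensity (hY : IsSample P G Y) : HasSum (mixtureDensity G) 1 := by
  have h : HasSum (fun y => P (Y 0 ⁻¹' {y})) 1 := by
    have h1 := tsum_measure_preimage_singleton (μ := P) (f := Y 0) (Set.to_countable Set.univ)
      fun y _ => hY.measurable 0 (measurableSet_singleton y)
    rw [Set.preimage_univ, measure_univ, tsum_univ (fun y => P (Y 0 ⁻¹' {y}))] at h1
    rw [← h1]
    exact ENNReal.summable.hasSum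
  have h2 := (ENNReal.hasSum_toReal (f := fun y => P (Y 0 ⁻¹' {y}))
    (by rw [h.tsum_eq]; exact ENNReal.one_ne_top))
  have h3 : (fun y => (P (Y 0 ⁻¹' {y})).toReal) = mixtureDensity G :=
    funext fun y => hY.density 0 y
  rw [← ENNReal.tsum_toReal_eq fun y => measure_ne_top _ _, h.tsum_eq, h3] at h2
  simpa using h2

lemma IsSample.ae_mixtureDensity_pos (hY : IsSample P G Y) :
    ∀ᵐ ω ∂P, ∀ i, 0 < mixtureDensity G (Y i ω) := by
  rw [ae_all_iff]
  intro i
  have h : ∀ y, ∀ᵐ ω ∂P, Y i ω = y → 0 < mixtureDensity G y := by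
    intro y
    rcases (mixtureDensity_nonneg G y).eq_or_lt with h0 | h0
    · have h1 : P (Y i ⁻¹' {y}) = 0 := by
        rw [← measureReal_eq_zero_iff, hY.density i y, ← h0]
      filter_upwards [measure_eq_zero_iff_ae_notMem.1 h1] with ω hω h2
      exact absurd h2 hω
    · exact ae_of_all _ fun _ _ => h0
  filter_upwards [ae_all_iff.2 h] with ω hω using hω _ rfl

lemma IsSample.ae_tendsto_freq (hY : IsSample P G Y) :
    ∀ᵐ ω ∂P, ∀ y, Tendsto (fun n => freq (fun i => Y i ω) n y) atTop
      (𝓝 (mixtureDensity G y)) := by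
  rw [ae_all_iff]
  intro y
  set φ : ℕ × ℕ → ℝ := Set.indicator {y} (fun _ => (1 : ℝ))
  have hφ : Measurable φ := Measurable.of_discrete
  have hmean : ∫ ω, φ (Y 0 ω) ∂P = mixtureDensity G y := by
    have h1 : (fun ω => φ (Y 0 ω)) = (Y 0 ⁻¹' {y}).indicator fun _ => (1 : ℝ) := by
      rfl
    rw [h1, integral_indicator_const _ (hY.measurable 0 (measurableSet_singleton y)),
      hY.density 0 y]
    simp
  have h := strong_law_ae_real (μ := P) (fun i ω => φ (Y i ω))
    (Integrable.of_bound (hφ.comp (hY.measurable 0)).aestronglyMeasurable 1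
      (ae_of_all _ fun ω => by
        by_cases hy : Y 0 ω = y <;> simp [φ, hy]))
    (fun i j hij => (hY.indep.indepFun hij).comp hφ hφ)
    (fun i => (hY.identDistrib i).comp hφ)
  rw [hmean] at h
  exact h

/-- Almost surely, the mixture densities of GMLEs converge pointwise to the true density. -/
lemma IsSample.ae_tendsto_mixtureDensity (hY : IsSample P G Y) {T : Set Param}
    (hG : IsDistributionOn T G) :
    ∀ᵐ ω ∂P, ∀ Ghat : ℕ → Measure Param,
      (∀ n : ℕ, 1 ≤ n → IsGMLE T (fun i : Fin n => Y i ω) (Ghat n)) →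
      ∀ y, Tendsto (fun n => mixtureDensity (Ghat n) y) atTop (𝓝 (mixtureDensity G y)) := by
  filter_upwards [hY.ae_mixtureDensity_pos, hY.ae_tendsto_freq] with ω hpos hfreq Ghat hGhat
  have key : ∀ n, 1 ≤ n → _ := fun n hn => (hGhat n hn).sum_ratio_le hG fun i => hpos i
  refine tendsto_of_sum_mul_ratio_le_one hY.hasSum_mixtureDensity (mixtureDensity_nonneg G)
    (Eventually.of_forall fun n => mixtureDensity_nonneg _) ?_ hfreq ?_ ?_
  · filter_upwards [eventually_ge_atTop 1] with n hn
    have := (hGhat n hn).1.1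
    exact sum_mixtureDensity_le_one (Ghat n)
  · filter_upwards [eventually_ge_atTop 1] with n hn y hy
    obtain ⟨i, hi, rfl⟩ := exists_eq_of_freq_pos hy
    exact (key n hn).1 ⟨i, hi⟩
  · filter_upwards [eventually_ge_atTop 1] with n hn A
    refine (sum_freq_mul_le (fun y => div_nonneg (mixtureDensity_nonneg _ _)
      (mixtureDensity_nonneg _ _)) A).trans ?_
    have h2 := (key n hn).2
    rw [Fin.sum_univ_eq_sum_range (fun i => mixtureDensity G (Y i ω) /
      mixtureDensity (Ghat n) (Y i ω))] at h2
    exact div_le_one_of_le₀ h2 n.cast_nonneg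

end Sample

/-! ### Weak convergence of the distribution of `ξ` -/

/-- A sequence converges to `L` if, up to arbitrarily small errors, it lies above a convergent
sequence with limit at least `L` and below one with limit at most `L`. -/
lemma tendsto_of_forall_squeeze {u : ℕ → ℝ} {L : ℝ}
    (hlow : ∀ ε > 0, ∃ (a : ℕ → ℝ) (A : ℝ), Tendsto a atTop (𝓝 A) ∧ L - ε ≤ A ∧
      ∀ᶠ n in atTop, a n ≤ u n + ε)
    (hup : ∀ ε > 0, ∃ (b : ℕ → ℝ) (B : ℝ), Tendsto b atTop (𝓝 B) ∧ B ≤ L + ε ∧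
      ∀ᶠ n in atTop, u n - ε ≤ b n) :
    Tendsto u atTop (𝓝 L) := by
  rw [Metric.tendsto_nhds]
  intro δ hδ
  obtain ⟨a, A, ha, hA, hau⟩ := hlow (δ / 4) (by positivity)
  obtain ⟨b, B, hb, hB, hub⟩ := hup (δ / 4) (by positivity)
  filter_upwards [hau, hub, ha.eventually (lt_mem_nhds (show A - δ / 4 < A by linarith)),
    hb.eventually (gt_mem_nhds (show B < B + δ / 4 by linarith))] with n h1 h2 h3 h4
  rw [Real.dist_eq, abs_lt]
  constructor <;> linarith

lemma IsDistributionOn.ae_mem {T : Set Param} {H : Measure Param} (h : IsDistributionOn T H) :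
    ∀ᵐ θ ∂H, θ ∈ T := mem_ae_iff.2 h.2

lemma exists_xi_mem_Icc {T : Set Param} (hT : Bornology.IsBounded T) :
    ∃ R : ℝ, ∀ θ ∈ T, xi θ ∈ Set.Icc ((0, 0) : ℝ × ℝ) (R, R) := by
  obtain ⟨R, hR⟩ := hT.subset_closedBall ((0, 0) : Param)
  refine ⟨R, fun θ hθ => ?_⟩
  have h1 : (θ.1 : ℝ) ≤ R := by
    have := (Metric.mem_closedBall.1 (hR hθ))
    rw [Prod.dist_eq] at this
    have := (le_max_left _ _).trans this
    simpa [NNReal.dist_eq] using this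
  have h0 : (0 : ℝ) ≤ θ.1 := θ.1.2
  have hp0 := θ.2.2.1
  have hp1 := θ.2.2.2
  simp only [xi, Set.mem_Icc, Prod.mk_le_mk]
  refine ⟨⟨by positivity, mul_nonneg (by linarith) h0⟩, ?_, ?_⟩ <;> nlinarith

lemma integrable_comp_xi {T : Set Param} (hT : Bornology.IsBounded T) {H : Measure Param}
    (hH : IsDistributionOn T H) {F : ℝ × ℝ → ℝ} (hF : Continuous F) :
    Integrable (fun θ => F (xi θ)) H := by
  have := hH.1
  obtain ⟨R, hR⟩ := exists_xi_mem_Icc hT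
  obtain ⟨C, hC⟩ := (isCompact_Icc (a := ((0, 0) : ℝ × ℝ))
    (b := (R, R))).exists_bound_of_continuousOn hF.continuousOn
  refine Integrable.of_bound (hF.comp continuous_xi).aestronglyMeasurable C ?_
  filter_upwards [hH.ae_mem] with θ hθ using hC _ (hR θ hθ)

/-- Up to the factor `exp (-(ξ₁ + ξ₂))` and a positive constant, the mixture densities are the
mixed moments of `(ξ₁, ξ₂)`. -/
lemma tendsto_integral_exp_mul_monomial {G : Measure Param}
    {Ghat : ℕ → Measure Param}
    (h : ∀ y, Tendsto (fun n => mixtureDensity (Ghat n) y) atTop (𝓝 (mixtureDensity G y)))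
    (a b : ℕ) :
    Tendsto (fun n => ∫ θ, Real.exp (-((xi θ).1 + (xi θ).2)) *
        ((xi θ).1 ^ a * (xi θ).2 ^ b) ∂(Ghat n)) atTop
      (𝓝 (∫ θ, Real.exp (-((xi θ).1 + (xi θ).2)) * ((xi θ).1 ^ a * (xi θ).2 ^ b) ∂G)) := by
  have hc : ((a + b).choose a / (a + b).factorial : ℝ) ≠ 0 := by
    have := Nat.choose_pos (Nat.le_add_right a b)
    positivity
  have h1 : ∀ H : Measure Param, ∫ θ, Real.exp (-((xi θ).1 + (xi θ).2)) *
      ((xi θ).1 ^ a * (xi θ).2 ^ b) ∂H =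
      ((a + b).choose a / (a + b).factorial : ℝ)⁻¹ * mixtureDensity H (a, a + b) := by
    intro H
    simp only [mixtureDensity, condDensity_eq, Nat.add_sub_cancel_left]
    rw [integral_const_mul, inv_mul_cancel_left₀ hc]
  simp only [h1]
  exact (h _).const_mul _

/-- Pointwise convergence of the mixture densities forces weak convergence of the distribution of
`(ξ₁, ξ₂)`: by Stone–Weierstrass, `F * exp (ξ₁ + ξ₂)` is uniformly close to a polynomial on a
compact set containing `ξ(T)`. -/
lemma tendsto_integral_comp_xi {T : Set Param} (hT : Bornology.IsBounded T) {G : Measure Param}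
    (hG : IsDistributionOn T G) {Ghat : ℕ → Measure Param}
    (hGhat : ∀ᶠ n in atTop, IsDistributionOn T (Ghat n))
    (h : ∀ y, Tendsto (fun n => mixtureDensity (Ghat n) y) atTop (𝓝 (mixtureDensity G y)))
    {F : ℝ × ℝ → ℝ} (hF : Continuous F) :
    Tendsto (fun n => ∫ θ, F (xi θ) ∂(Ghat n)) atTop (𝓝 (∫ θ, F (xi θ) ∂G)) := by
  set X : C(ℝ × ℝ, ℝ) := ⟨Prod.fst, continuous_fst⟩
  set Z : C(ℝ × ℝ, ℝ) := ⟨Prod.snd, continuous_snd⟩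
  set E : ℝ × ℝ → ℝ := fun x => Real.exp (-(x.1 + x.2)) with hE
  have hEc : Continuous E := by fun_prop
  have hint : ∀ H, IsDistributionOn T H → ∀ g : C(ℝ × ℝ, ℝ),
      Integrable (fun θ => E (xi θ) * g (xi θ)) H :=
    fun H hH g => integrable_comp_xi hT hH (hEc.mul g.continuous)
  have hpoly : ∀ g ∈ Algebra.adjoin ℝ ({X, Z} : Set C(ℝ × ℝ, ℝ)),
      Tendsto (fun n => ∫ θ, E (xi θ) * g (xi θ) ∂(Ghat n)) atTop
        (𝓝 (∫ θ, E (xi θ) * g (xi θ) ∂G)) := by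
    intro g hg
    rw [← Subalgebra.mem_toSubmodule, Algebra.adjoin_eq_span] at hg
    induction hg using Submodule.span_induction with
    | mem g hg =>
      obtain ⟨a, b, rfl⟩ := (Submonoid.mem_closure_pair X Z g).1 hg
      exact tendsto_integral_exp_mul_monomial h a b
    | zero => simp
    | add g₁ g₂ _ _ h₁ h₂ =>
      have hadd : ∀ H, IsDistributionOn T H → ∫ θ, E (xi θ) * (g₁ + g₂) (xi θ) ∂H =
          ∫ θ, E (xi θ) * g₁ (xi θ) ∂H + ∫ θ, E (xi θ) * g₂ (xi θ) ∂H := by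
        intro H hH
        rw [← integral_add (hint H hH g₁) (hint H hH g₂)]
        simp [mul_add]
      rw [hadd G hG]
      refine (h₁.add h₂).congr' ?_
      filter_upwards [hGhat] with n hn using (hadd _ hn).symm
    | smul c g _ h₁ =>
      have hsmul : ∀ H : Measure Param, ∫ θ, E (xi θ) * (c • g) (xi θ) ∂H =
          c * ∫ θ, E (xi θ) * g (xi θ) ∂H := by
        intro H
        rw [← integral_const_mul]
        simp [mul_left_comm]
      simp only [hsmul]
      exact h₁.const_mul c
  have hsep : (Algebra.adjoin ℝ ({X, Z} : Set C(ℝ × ℝ, ℝ))).SeparatesPoints := by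
    intro x y hxy
    by_cases h1 : x.1 = y.1
    · exact ⟨Z, ⟨Z, Algebra.subset_adjoin (by simp), rfl⟩, fun h2 => hxy (Prod.ext h1 h2)⟩
    · exact ⟨X, ⟨X, Algebra.subset_adjoin (by simp), rfl⟩, h1⟩
  obtain ⟨R, hR⟩ := exists_xi_mem_Icc hT
  have happrox : ∀ ε > 0, ∃ g ∈ Algebra.adjoin ℝ ({X, Z} : Set C(ℝ × ℝ, ℝ)),
      ∀ H, IsDistributionOn T H →
        |∫ θ, E (xi θ) * g (xi θ) ∂H - ∫ θ, F (xi θ) ∂H| ≤ ε := by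
    intro ε hε
    obtain ⟨g, hg, hgε⟩ :=
      ContinuousMap.exists_mem_subalgebra_near_continuous_of_isCompact_of_separatesPoints hsep
        ⟨fun x => F x * Real.exp (x.1 + x.2), by fun_prop⟩
        (isCompact_Icc (a := ((0, 0) : ℝ × ℝ)) (b := (R, R))) hε
    refine ⟨g, hg, fun H hH => ?_⟩
    have := hH.1
    rw [← integral_sub (hint H hH g)
      (integrable_comp_xi hT hH hF), ← Real.norm_eq_abs]
    refine (norm_integral_le_of_norm_le_const (C := ε) ?_).trans (by simp)
    filter_upwards [hH.ae_mem] with θ hθ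
    have hx := hR θ hθ
    have hE1 : E (xi θ) ≤ 1 := by
      have h1 : (0 : ℝ) ≤ (xi θ).1 := hx.1.1
      have h2 : (0 : ℝ) ≤ (xi θ).2 := hx.1.2
      exact Real.exp_le_one_iff.2 (by linarith)
    have hE0 : 0 < E (xi θ) := Real.exp_pos _
    have heq : E (xi θ) * g (xi θ) - F (xi θ) =
        E (xi θ) * (g (xi θ) - F (xi θ) * Real.exp ((xi θ).1 + (xi θ).2)) := by
      have : E (xi θ) * Real.exp ((xi θ).1 + (xi θ).2) = 1 := by
        simp [hE, ← Real.exp_add]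
      linear_combination F (xi θ) * this
    rw [heq, norm_mul, Real.norm_of_nonneg hE0.le]
    calc E (xi θ) * _ ≤ 1 * ε := mul_le_mul hE1 (hgε _ hx).le (norm_nonneg _) zero_le_one
      _ = ε := one_mul ε
  refine tendsto_of_forall_squeeze (fun ε hε => ?_) fun ε hε => ?_
  all_goals
    obtain ⟨g, hg, hgε⟩ := happrox ε hε
    refine ⟨_, _, hpoly g hg, ?_, ?_⟩
    · have := abs_le.1 (hgε G hG); linarith
    · filter_upwards [hGhat] with n hn
      have := abs_le.1 (hgε _ hn); linarith

/-! ### Lipschitz minorants -/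

/-- The largest `k`-Lipschitz minorant of `ψ` on `S` (an inf-convolution), as a function on the
whole plane. -/
noncomputable def lipMinorant (S : Set (ℝ × ℝ)) (ψ : ℝ × ℝ → ℝ) (k : ℕ) (x : ℝ × ℝ) : ℝ :=
  ⨅ s : S, (ψ s + k * dist x s)

section Minorant

variable {S : Set (ℝ × ℝ)} {ψ : ℝ × ℝ → ℝ} {C : ℝ}

lemma bddBelow_range_lipMinorant (hC : ∀ x ∈ S, |ψ x| ≤ C) (k : ℕ) (x : ℝ × ℝ) :
    BddBelow (Set.range fun s : S => ψ s + k * dist x s) := by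
  refine ⟨-C, ?_⟩
  rintro _ ⟨s, rfl⟩
  have := (abs_le.1 (hC s s.2)).1
  have : 0 ≤ (k : ℝ) * dist x s := by positivity
  dsimp only; linarith

lemma lipMinorant_le (hC : ∀ x ∈ S, |ψ x| ≤ C) (k : ℕ) {x : ℝ × ℝ} (hx : x ∈ S) :
    lipMinorant S ψ k x ≤ ψ x :=
  (ciInf_le (bddBelow_range_lipMinorant hC k x) ⟨x, hx⟩).trans (by simp)

lemma continuous_lipMinorant (hS : S.Nonempty) (hC : ∀ x ∈ S, |ψ x| ≤ C) (k : ℕ) :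
    Continuous (lipMinorant S ψ k) := by
  have := hS.to_subtype
  refine (LipschitzWith.of_le_add_mul (k : ℝ≥0) fun x y => ?_).continuous
  rw [← sub_le_iff_le_add]
  refine le_ciInf fun s => ?_
  rw [sub_le_iff_le_add]
  refine (ciInf_le (bddBelow_range_lipMinorant hC k x) s).trans ?_
  have := mul_le_mul_of_nonneg_left (dist_triangle x y s) k.cast_nonneg (α := ℝ)
  simp only [NNReal.coe_natCast]
  linarith

lemma abs_lipMinorant_le (hC : ∀ x ∈ S, |ψ x| ≤ C) (k : ℕ) {x : ℝ × ℝ} (hx : x ∈ S) :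
    |lipMinorant S ψ k x| ≤ C := by
  have : Nonempty S := ⟨⟨x, hx⟩⟩
  refine abs_le.2 ⟨le_ciInf fun s => ?_,
    (lipMinorant_le hC k hx).trans (abs_le.1 (hC x hx)).2⟩
  have := (abs_le.1 (hC s s.2)).1
  have : 0 ≤ (k : ℝ) * dist x s := by positivity
  linarith

lemma tendsto_lipMinorant (hC : ∀ x ∈ S, |ψ x| ≤ C) {x : ℝ × ℝ} (hx : x ∈ S)
    (hψ : ContinuousWithinAt ψ S x) :
    Tendsto (fun k => lipMinorant S ψ k x) atTop (𝓝 (ψ x)) := by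
  have : Nonempty S := ⟨⟨x, hx⟩⟩
  rw [Metric.tendsto_nhds]
  intro ε hε
  obtain ⟨δ, hδ, hδε⟩ := Metric.continuousWithinAt_iff.1 hψ (ε / 2) (by positivity)
  filter_upwards [(tendsto_natCast_atTop_atTop (R := ℝ)).eventually_ge_atTop (2 * C / δ)] with k hk
  rw [div_le_iff₀ hδ] at hk
  have hlow : ψ x - ε / 2 ≤ lipMinorant S ψ k x := by
    refine le_ciInf fun s => ?_
    rcases lt_or_ge (dist (s : ℝ × ℝ) x) δ with hs | hs
    · have h1 := (abs_lt.1 (hδε s.2 hs)).1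
      have : 0 ≤ (k : ℝ) * dist x s := by positivity
      linarith
    · -- Far from `x` the penalty `k * dist x s ≥ 2 * C` exceeds the oscillation of `ψ`.
      have h1 := (abs_le.1 (hC s s.2)).1
      have h2 := (abs_le.1 (hC x hx)).2
      have h3 := mul_le_mul_of_nonneg_left hs k.cast_nonneg (α := ℝ)
      rw [dist_comm] at h3
      linarith
  have hup := lipMinorant_le hC k hx
  rw [Real.dist_eq, abs_lt]
  constructor <;> linarith

end Minorant

/-! ### Convergence of functionals -/

/-- `T` itself need not be measurable, but it contains a measurable set of full `H`-measure. -/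
lemma integrable_bounded_comp_xi {T : Set Param} {H : Measure Param} (hH : IsDistributionOn T H)
    {ψ : ℝ × ℝ → ℝ} {C : ℝ} (hψ : Measurable fun x : (xi '' T : Set (ℝ × ℝ)) => ψ x)
    (hC : ∀ x ∈ xi '' T, |ψ x| ≤ C) : Integrable (fun θ => ψ (xi θ)) H := by
  have := hH.1
  have hmeas : AEMeasurable (fun θ => ψ (xi θ)) H := by
    set T' : Set Param := (toMeasurable H Tᶜ)ᶜ
    have hT' : MeasurableSet T' := (measurableSet_toMeasurable _ _).compl
    have hsub : T' ⊆ T := Set.compl_subset_comm.1 (subset_toMeasurable H Tᶜ)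
    have hnull : ∀ᵐ θ ∂H, θ ∈ T' :=
      mem_ae_iff.2 (by
        change H (toMeasurable H Tᶜ)ᶜᶜ = 0
        rw [compl_compl, measure_toMeasurable, hH.2])
    rw [← Measure.restrict_eq_self_of_ae_mem hnull]
    refine aemeasurable_restrict_of_measurable_subtype hT' ?_
    have hm : Measurable fun θ : T' =>
        (⟨xi θ, Set.mem_image_of_mem xi (hsub θ.2)⟩ : (xi '' T : Set (ℝ × ℝ))) :=
      (continuous_xi.measurable.comp measurable_subtype_coe).subtype_mk
    exact hψ.comp hm
  refine Integrable.of_bound hmeas.aestronglyMeasurable C ?_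
  filter_upwards [hH.ae_mem] with θ hθ using hC _ (Set.mem_image_of_mem xi hθ)

/-- A bounded function continuous at almost every value of `(ξ₁, ξ₂)` under `G` has continuous
minorants on `ξ(T)` whose `G`-expectations approach its own. -/
lemma exists_continuous_minorant {T : Set Param} {G : Measure Param} (hG : IsDistributionOn T G)
    {ψ : ℝ × ℝ → ℝ} {C : ℝ} (hC : ∀ x ∈ xi '' T, |ψ x| ≤ C)
    (hcont : ∀ x ∈ xi '' T, x ∈ (G.map xi).support → ContinuousWithinAt ψ (xi '' T) x)
    {ε : ℝ} (hε : 0 < ε) :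
    ∃ F : ℝ × ℝ → ℝ, Continuous F ∧ (∀ x ∈ xi '' T, F x ≤ ψ x) ∧
      ∫ θ, ψ (xi θ) ∂G - ε ≤ ∫ θ, F (xi θ) ∂G := by
  have := hG.1
  have hne : (xi '' T).Nonempty := by
    obtain ⟨θ, hθ⟩ := hG.ae_mem.exists
    exact ⟨_, Set.mem_image_of_mem xi hθ⟩
  have hsupp : ∀ᵐ θ ∂G, xi θ ∈ (G.map xi).support :=
    ae_of_ae_map continuous_xi.aemeasurable Measure.support_mem_ae
  have hlim : Tendsto (fun k => ∫ θ, lipMinorant (xi '' T) ψ k (xi θ) ∂G) atTop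
      (𝓝 (∫ θ, ψ (xi θ) ∂G)) := by
    refine tendsto_integral_of_dominated_convergence (fun _ => C)
      (fun k => ((continuous_lipMinorant hne hC k).comp continuous_xi).aestronglyMeasurable)
      (integrable_const C) (fun k => ?_) ?_
    · filter_upwards [hG.ae_mem] with θ hθ using
        abs_lipMinorant_le hC k (Set.mem_image_of_mem xi hθ)
    · filter_upwards [hG.ae_mem, hsupp] with θ hθ hs using
        tendsto_lipMinorant hC (Set.mem_image_of_mem xi hθ)
          (hcont _ (Set.mem_image_of_mem xi hθ) hs)
  obtain ⟨k, hk⟩ := (hlim.eventually (lt_mem_nhds (sub_lt_self _ hε))).exists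
  exact ⟨_, continuous_lipMinorant hne hC k, fun x hx => lipMinorant_le hC k hx, hk.le⟩

section Limits

variable {T : Set Param} {G : Measure Param} {Ghat : ℕ → Measure Param}

lemma tendsto_integral_of_ae_continuous (hT : Bornology.IsBounded T) (hG : IsDistributionOn T G)
    (hGhat : ∀ᶠ n in atTop, IsDistributionOn T (Ghat n))
    (h : ∀ F : ℝ × ℝ → ℝ, Continuous F →
      Tendsto (fun n => ∫ θ, F (xi θ) ∂(Ghat n)) atTop (𝓝 (∫ θ, F (xi θ) ∂G)))
    {ψ : ℝ × ℝ → ℝ} {C : ℝ} (hψ : Measurable fun x : (xi '' T : Set (ℝ × ℝ)) => ψ x)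
    (hC : ∀ x ∈ xi '' T, |ψ x| ≤ C)
    (hcont : ∀ x ∈ xi '' T, x ∈ (G.map xi).support → ContinuousWithinAt ψ (xi '' T) x) :
    Tendsto (fun n => ∫ θ, ψ (xi θ) ∂(Ghat n)) atTop (𝓝 (∫ θ, ψ (xi θ) ∂G)) := by
  refine tendsto_of_forall_squeeze (fun ε hε => ?_) fun ε hε => ?_
  · obtain ⟨F, hF, hle, hFG⟩ := exists_continuous_minorant hG hC hcont hε
    refine ⟨_, _, h F hF, hFG, ?_⟩
    filter_upwards [hGhat] with n hn
    have : ∫ θ, F (xi θ) ∂(Ghat n) ≤ ∫ θ, ψ (xi θ) ∂(Ghat n) := by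
      refine integral_mono_ae (integrable_comp_xi hT hn hF)
        (integrable_bounded_comp_xi hn hψ hC) ?_
      filter_upwards [hn.ae_mem] with θ hθ using hle _ (Set.mem_image_of_mem xi hθ)
    linarith
  · obtain ⟨F, hF, hle, hFG⟩ := exists_continuous_minorant (ψ := fun x => -ψ x) hG
      (fun x hx => (abs_neg (ψ x)).trans_le (hC x hx)) (fun x hx hs => (hcont x hx hs).neg) hε
    rw [integral_neg] at hFG
    refine ⟨_, _, (h F hF).neg, by linarith, ?_⟩
    filter_upwards [hGhat] with n hn
    have : ∫ θ, F (xi θ) ∂(Ghat n) ≤ ∫ θ, -ψ (xi θ) ∂(Ghat n) := by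
      refine integral_mono_ae (integrable_comp_xi hT hn hF)
        (integrable_bounded_comp_xi hn hψ hC).neg ?_
      filter_upwards [hn.ae_mem] with θ hθ using hle _ (Set.mem_image_of_mem xi hθ)
    rw [integral_neg] at this
    linarith

/-- `p` is not a function of `(ξ₁, ξ₂)` at rate `0`; but `p * min 1 (c * rate)` and
`min 1 (c * rate)` are continuous functions of `(ξ₁, ξ₂)`, and `p` lies between
`p * min 1 (c * rate)` and `p * min 1 (c * rate) + (1 - min 1 (c * rate))`. -/
lemma tendsto_integral_prob (hT : Bornology.IsBounded T) (hG : IsDistributionOn T G)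
    (hGhat : ∀ᶠ n in atTop, IsDistributionOn T (Ghat n))
    (h : ∀ F : ℝ × ℝ → ℝ, Continuous F →
      Tendsto (fun n => ∫ θ, F (xi θ) ∂(Ghat n)) atTop (𝓝 (∫ θ, F (xi θ) ∂G)))
    (h0 : G {θ | θ.1 = 0} = 0) :
    Tendsto (fun n => ∫ θ, (θ.2 : ℝ) ∂(Ghat n)) atTop (𝓝 (∫ θ, (θ.2 : ℝ) ∂G)) := by
  have := hG.1
  set F : ℕ → ℝ × ℝ → ℝ := fun k x => x.1 / max (x.1 + x.2) (1 / (k + 1)) with hFdef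
  set D : ℕ → ℝ × ℝ → ℝ := fun k x => 1 - min 1 ((k + 1) * (x.1 + x.2)) with hDdef
  have hFc : ∀ k, Continuous (F k) := fun k =>
    Continuous.div (by fun_prop) (by fun_prop) fun x =>
      (lt_max_of_lt_right (by positivity : (0 : ℝ) < 1 / (k + 1))).ne'
  have hDc : ∀ k, Continuous (D k) := fun k => by fun_prop
  have hxi : ∀ θ, (xi θ).1 + (xi θ).2 = (θ.1 : ℝ) := fun θ => by simp only [xi]; ring
  have hbounds : ∀ k θ, F k (xi θ) ≤ θ.2 ∧ (θ.2 : ℝ) ≤ F k (xi θ) + D k (xi θ) := by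
    intro k θ
    have hl : (0 : ℝ) ≤ θ.1 := θ.1.2
    have hp0 := θ.2.2.1
    have hp1 := θ.2.2.2
    have hk : (0 : ℝ) < k + 1 := by positivity
    have hFe : F k (xi θ) = θ.2 * θ.1 / max (θ.1 : ℝ) (1 / (k + 1)) := by
      simp only [hFdef, hxi]; rfl
    have hDe : D k (xi θ) = 1 - min 1 ((k + 1) * (θ.1 : ℝ)) := by simp only [hDdef, hxi]
    rw [hFe, hDe]
    rcases le_total (1 / ((k : ℝ) + 1)) θ.1 with hle | hle
    · have hpos : (0 : ℝ) < θ.1 := lt_of_lt_of_le (by positivity) hle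
      rw [max_eq_left hle, mul_div_cancel_right₀ _ hpos.ne']
      exact ⟨le_rfl, by linarith [min_le_left 1 ((k + 1) * (θ.1 : ℝ))]⟩
    · have h1 : (k + 1) * (θ.1 : ℝ) ≤ 1 := by
        rw [le_div_iff₀ hk] at hle; linarith
      have h2 : 0 ≤ (k + 1) * (θ.1 : ℝ) := by positivity
      have h3 : (θ.2 : ℝ) * θ.1 / (1 / (k + 1)) = θ.2 * ((k + 1) * θ.1) := by
        field_simp
      rw [max_eq_right hle, min_eq_right h1, h3]
      constructor <;> nlinarith
  have hpint : ∀ H, IsDistributionOn T H → Integrable (fun θ : Param => (θ.2 : ℝ)) H := by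
    intro H hH
    have := hH.1
    refine Integrable.of_bound (by fun_prop) 1 (ae_of_all _ fun θ => ?_)
    rw [Real.norm_of_nonneg θ.2.2.1]
    exact θ.2.2.2
  have hlow : ∀ k H, IsDistributionOn T H →
      ∫ θ, F k (xi θ) ∂H ≤ ∫ θ, (θ.2 : ℝ) ∂H := fun k H hH =>
    integral_mono (integrable_comp_xi hT hH (hFc k)) (hpint H hH) fun θ => (hbounds k θ).1
  have hup : ∀ k H, IsDistributionOn T H →
      ∫ θ, (θ.2 : ℝ) ∂H ≤ ∫ θ, F k (xi θ) ∂H + ∫ θ, D k (xi θ) ∂H := by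
    intro k H hH
    rw [← integral_add (integrable_comp_xi hT hH (hFc k)) (integrable_comp_xi hT hH (hDc k))]
    exact integral_mono (hpint H hH)
      ((integrable_comp_xi hT hH (hFc k)).add (integrable_comp_xi hT hH (hDc k)))
      fun θ => (hbounds k θ).2
  have hDlim : Tendsto (fun k => ∫ θ, D k (xi θ) ∂G) atTop (𝓝 0) := by
    have hz : ∫ _, (0 : ℝ) ∂G = 0 := by simp
    rw [← hz]
    refine tendsto_integral_of_dominated_convergence (fun _ => 1)
      (fun k => ((hDc k).comp continuous_xi).aestronglyMeasurable) (integrable_const 1)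
      (fun k => ae_of_all _ fun θ => ?_) ?_
    · have h1 : 0 ≤ (k + 1) * (θ.1 : ℝ) := by positivity
      simp only [hDdef, hxi, Real.norm_eq_abs]
      rw [abs_le]
      constructor
      · linarith [min_le_left 1 ((k + 1) * (θ.1 : ℝ))]
      · linarith [le_min zero_le_one h1]
    · filter_upwards [measure_eq_zero_iff_ae_notMem.1 h0] with θ hθ
      have hpos : (0 : ℝ) < θ.1 := NNReal.coe_pos.2 (pos_iff_ne_zero.2 hθ)
      refine tendsto_const_nhds.congr' ?_
      filter_upwards [(tendsto_natCast_atTop_atTop (R := ℝ)).eventually_ge_atTop (1 / (θ.1 : ℝ))]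
        with k hk
      rw [div_le_iff₀ hpos] at hk
      simp only [hDdef, hxi]
      rw [min_eq_left (by linarith), sub_self]
  refine tendsto_of_forall_squeeze (fun ε hε => ?_) fun ε hε => ?_
  all_goals
    obtain ⟨k, hk⟩ := (hDlim.eventually (gt_mem_nhds hε)).exists
  · refine ⟨_, _, h (F k) (hFc k), by linarith [hup k G hG], ?_⟩
    filter_upwards [hGhat] with n hn
    linarith [hlow k _ hn]
  · refine ⟨_, _, (h (F k) (hFc k)).add (h (D k) (hDc k)), by linarith [hlow k G hG], ?_⟩
    filter_upwards [hGhat] with n hn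
    linarith [hup k _ hn]

end Limits

end PoissonMixture

theorem mainTheorem2
    {Ω : Type*} [MeasurableSpace Ω] (P : Measure Ω) [IsProbabilityMeasure P]
    (T : Set PoissonMixture.Param) (hT : Bornology.IsBounded T)
    (G : Measure PoissonMixture.Param) (hG : PoissonMixture.IsDistributionOn T G)
    (Y : ℕ → Ω → ℕ × ℕ) (hY : PoissonMixture.IsSample P G Y) :
    ∀ᵐ ω ∂P, ∀ Ghat : ℕ → Measure PoissonMixture.Param,
      (∀ n : ℕ, 1 ≤ n → PoissonMixture.IsGMLE T (fun i : Fin n => Y i ω) (Ghat n)) →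
      (∀ ψ : ℝ × ℝ → ℝ,
        Measurable (fun x : (PoissonMixture.xi '' T : Set (ℝ × ℝ)) => ψ x) →
        (∃ C : ℝ, ∀ x ∈ PoissonMixture.xi '' T, |ψ x| ≤ C) →
        (∀ x ∈ PoissonMixture.xi '' T, x ∈ (G.map PoissonMixture.xi).support →
          ContinuousWithinAt ψ (PoissonMixture.xi '' T) x) →
        Tendsto (fun n => ∫ θ, ψ (PoissonMixture.xi θ) ∂(Ghat n)) atTop
          (𝓝 (∫ θ, ψ (PoissonMixture.xi θ) ∂G))) ∧
      (G {θ | θ.1 = 0} = 0 →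
        Tendsto (fun n => ∫ θ, (θ.2 : ℝ) ∂(Ghat n)) atTop
          (𝓝 (∫ θ, (θ.2 : ℝ) ∂G))) := by
  filter_upwards [hY.ae_tendsto_mixtureDensity hG] with ω hω Ghat hGhat
  have hdist : ∀ᶠ n in atTop, PoissonMixture.IsDistributionOn T (Ghat n) := by
    filter_upwards [eventually_ge_atTop 1] with n hn using (hGhat n hn).1
  have hweak : ∀ F : ℝ × ℝ → ℝ, Continuous F →
      Tendsto (fun n => ∫ θ, F (PoissonMixture.xi θ) ∂(Ghat n)) atTop
        (𝓝 (∫ θ, F (PoissonMixture.xi θ) ∂G)) := fun F hF =>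
    PoissonMixture.tendsto_integral_comp_xi hT hG hdist (hω Ghat hGhat) hF
  exact ⟨fun ψ hψ ⟨_, hC⟩ hcont =>
      PoissonMixture.tendsto_integral_of_ae_continuous hT hG hdist hweak hψ hC hcont,
    fun h0 => PoissonMixture.tendsto_integral_prob hT hG hdist hweak h0⟩
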